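/- **Setting.** Let $X$ be a closed subset of a separable Banach space, with the induced metric $d_X$; let $Y$ be a complete separable metric space and $\mathcal H$ a separable real Hilbert space. Let $F\colon X\rightsquigarrow Y$ be a set-valued function with non-empty images $Z_x:=F(x)$ and closed graph $Z:=\{(x,y)\in X\times Y: y\in Z_x\}$, and let $g\colon Z\to\mathcal H$ and $f\colon\mathcal H\to\mathbb R$. For a Borel probability measure $m$ on $X$ let $\mathcal P_m(Z)$ be the set of Borel probability measures on $Z$ whose marginal on $X$ is $m$, and consider $$(\mathrm P_m)\qquad \mathrm{val}(\mathrm P_m)=\inf_{\mu\in\mathcal P_m(Z)} f\Big(\int_Z g\,d\mu\Big).$$ For $\epsilon\ge 0$, an $\epsilon$-minimizer of $(\mathrm P_m)$ is a $\mu\in\mathcal P_m(Z)$ with $f(\int_Z g\,d\mu)\le \mathrm{val}(\mathrm P_m)+\epsilon$. **Assumptions.** (A1) $g$ is bounded; $f$ is convex and differentiable, and $\nabla f$ is Lipschitz continuous with modulus $L$. (A2) For every $\lambda\in\nabla f(\mathcal H)$: the function $g_\lambda:=\langle\lambda,g\rangle$ is lower semi-continuous on $Z$; the set-valued function $x\mapsto\{g_\lambda(x,y):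 y\in Z_x\}$ is lower semi-continuous; and $y\mapsto g_\lambda(x,y)$ attains its minimum on $Z_x$ for every $x\in X$. (B) $g$ is continuous; every $Z_x$ is compact and $F$ is upper semi-continuous; and $L_g\ge 0$ is such that the set-valued function $\mathcal Z(x):=\{g(x,y): y\in Z_x\}$ is $L_g$-Lipschitz, i.e. $\mathcal Z(x_1)\subseteq \mathcal Z(x_2)+\bar B(0,L_g d_X(x_1,x_2))$ for all $x_1,x_2\in X$. Set $$M:=\sup_{z\in Z}\|g(z)\|,\qquad C:=\sup_{\mu\in\mathcal P(Z)}\Big\|\nabla f\Big(\int_Z g\,d\mu\Big)\Big\|,\qquad d_1(m_0,m_1):=\sup_{\varphi\ 1\text{-Lipschitz}}\int_X\varphi\,d(m_0-m_1),$$ where $\mathcal P(Z)$ is the set of Borel probability measures on $Z$ and $\varphi$ ranges over the $1$-Lipschitz functions $X\to\mathbb R$. **Bridging method.** Given $m_0,m_1$ and $\bar\mu_0\in\mathcal P_{m_0}(Z)$: choose a coupling $\rho$ of $m_0$ and $m_1$ that minimizes $\int d_X(x,x')\,d\rho(x,x')$ among all couplings; choose a probability measure $\nu$ on $Z\times X$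 whose image under $(x,y,x')\mapsto(x,y)$ is $\bar\mu_0$ and whose image under $(x,y,x')\mapsto(x,x')$ is $\rho$; choose a Borel map $s\colon Z\times X\to Z$ with $s(x,y,x')\in S(x,y,x')$ everywhere, where $$S(x,y,x'):=\{(x',y')\in Z:\ \|g(x',y')-g(x,y)\|\le L_g\,d_X(x,x')\}.$$ The output is the push-forward $\mu_1:=s\#\nu$. **Theorem.** Under (A1), (A2) and (B), let $m_0,m_1$ be Borel probability measures on $X$ with finite first moment. Then: 1. $\mathrm{val}(\mathrm P_{m_0})$ and $\mathrm{val}(\mathrm P_{m_1})$ are finite (the feasible sets are non-empty and the costs bounded below), and $$|\mathrm{val}(\mathrm P_{m_0})-\mathrm{val}(\mathrm P_{m_1})|\le L_g\,(C+LM)\,d_1(m_0,m_1).$$ 2. Let $\epsilon_0\ge 0$ and let $\bar\mu_0$ be an $\epsilon_0$-minimizer of $(\mathrm P_{m_0})$. Then the bridging method with input $m_0,m_1,\bar\mu_0$ can be carried out, and every output $\mu_1$ of it belongs to $\mathcal P_{m_1}(Z)$ and is an $\eta$-minimizer of $(\mathrm P_{m_1})$ with $$\eta=\epsilon_0+2L_g\,(C+LM)\,d_1(m_0,m_1).$$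 -/

import Mathlib

open MeasureTheory Set
open scoped NNReal ENNReal Pointwise

noncomputable section

namespace MFO

/-- The Borel probability measure `m` has a finite first moment. -/
def FiniteFirstMoment {X : Type*} [MetricSpace X] [MeasurableSpace X] (m : Measure X) : Prop :=
  IsProbabilityMeasure m ∧ ∃ x₀ : X, Integrable (fun x => dist x x₀) m

/-- The Kantorovich–Rubinstein distance: the supremum of `∫ φ d(m₀ - m₁)` over all `1`-Lipschitz
functions `φ`. -/
def krDist {X : Type*} [MetricSpace X] [MeasurableSpace X] (m₀ m₁ : Measure X) : ℝ :=
  ⨆ φ : {φ : X → ℝ // LipschitzWith 1 φ}, ((∫ x, φ.1 x ∂m₀) - ∫ x, φ.1 x ∂m₁)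

/-- The set `Π(m₀, m₁)` of couplings. -/
def couplings {X X' : Type*} [MeasurableSpace X] [MeasurableSpace X']
    (m₀ : Measure X) (m₁ : Measure X') : Set (Measure (X × X')) :=
  {ρ | IsProbabilityMeasure ρ ∧ ρ.map Prod.fst = m₀ ∧ ρ.map Prod.snd = m₁}

/-- `ρ` solves the optimal transport problem between `m₀` and `m₁` with cost the distance. -/
def IsOptimalCoupling {X : Type*} [MetricSpace X] [MeasurableSpace X]
    (m₀ m₁ : Measure X) (ρ : Measure (X × X)) : Prop :=
  ρ ∈ couplings m₀ m₁ ∧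
    ∀ ρ' ∈ couplings m₀ m₁, ∫⁻ p, edist p.1 p.2 ∂ρ ≤ ∫⁻ p, edist p.1 p.2 ∂ρ'

/-- The graph of a set-valued function. -/
def graph {X Y : Type*} (F : X → Set Y) : Set (X × Y) := {p | p.2 ∈ F p.1}

/-- The set-valued function `F` is `K`-Lipschitz: `F x₁ ⊆ F x₂ + B(0, K d(x₁, x₂))`, with closed
balls. -/
def SetValuedLipschitz {X H : Type*} [MetricSpace X] [NormedAddCommGroup H]
    (K : ℝ) (F : X → Set H) : Prop :=
  ∀ x₁ x₂ : X, F x₁ ⊆ F x₂ + Metric.closedBall (0 : H) (K * dist x₁ x₂)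

section Problem

variable {X Y H : Type*} [MetricSpace X] [MeasurableSpace X] [MetricSpace Y] [MeasurableSpace Y]
  [NormedAddCommGroup H] [InnerProductSpace ℝ H] [CompleteSpace H]

/-- The set of probability measures on `Z = graph F` whose first marginal is `m`. -/
def admissible (F : X → Set Y) (m : Measure X) : Set (Measure (graph F)) :=
  {μ | IsProbabilityMeasure μ ∧ μ.map (fun z => z.1.1) = m}

/-- The cost `f (∫_Z g dμ)`. -/
def cost {F : X → Set Y} (g : graph F → H) (f : H → ℝ) (μ : Measure (graph F)) : ℝ :=
  f (∫ z, g z ∂μ)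

/-- The value of the problem with marginal `m`. -/
def val {F : X → Set Y} (g : graph F → H) (f : H → ℝ) (m : Measure X) : ℝ :=
  sInf (cost g f '' admissible F m)

/-- `μ` is an `ε`-minimizer of the problem with marginal `m`. -/
def IsApproxMinimizer {F : X → Set Y} (g : graph F → H) (f : H → ℝ) (m : Measure X)
    (ε : ℝ) (μ : Measure (graph F)) : Prop :=
  μ ∈ admissible F m ∧ ∀ μ' ∈ admissible F m, cost g f μ ≤ cost g f μ' + ε

/-- The set-valued function `x ↦ {⟪l, g (x, y)⟫ | y ∈ F x}`. -/
def scalarImage {F : X → Set Y} (g : graph F → H) (l : H) (x : X) : Set ℝ :=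
  {r | ∃ (y : Y) (hy : y ∈ F x), r = inner ℝ l (g ⟨(x, y), hy⟩)}

/-- The best responses, i.e. the minimizers of `y ↦ ⟪l, g (x, y)⟫` over `F x`. -/
def bestResponse {F : X → Set Y} (g : graph F → H) (l : H) (x : X) : Set Y :=
  {y | ∃ hy : y ∈ F x, ∀ (y' : Y) (hy' : y' ∈ F x),
    inner ℝ l (g ⟨(x, y), hy⟩) ≤ inner ℝ l (g ⟨(x, y'), hy'⟩)}

/-- The set-valued function `x ↦ {g (x, y) | y ∈ F x}`. -/
def contributions {F : X → Set Y} (g : graph F → H) (x : X) : Set H :=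
  {h | ∃ (y : Y) (hy : y ∈ F x), h = g ⟨(x, y), hy⟩}

/-- The regularity assumptions on the cost; `L` is a Lipschitz modulus of `∇ f`. -/
structure CostAssumption {F : X → Set Y} (g : graph F → H) (f : H → ℝ) (L : ℝ≥0) : Prop where
  bounded : ∃ B : ℝ, ∀ z, ‖g z‖ ≤ B
  convex : ConvexOn ℝ univ f
  differentiable : Differentiable ℝ f
  lipschitz_gradient : LipschitzWith L (gradient f)
  lsc : ∀ l ∈ range (gradient f), LowerSemicontinuous fun z => inner ℝ l (g z)
  lsc_image : ∀ l ∈ range (gradient f), LowerHemicontinuous (scalarImage g l)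
  bestResponse_nonempty : ∀ l ∈ range (gradient f), ∀ x, (bestResponse g l x).Nonempty

/-- The assumptions of the stability analysis, apart from the one on the space `X`; `Lg` is a
Lipschitz modulus of `contributions g`. -/
structure StabilityAssumption {F : X → Set Y} (g : graph F → H) (Lg : ℝ) : Prop where
  continuous : Continuous g
  compact : ∀ x, IsCompact (F x)
  usc : UpperHemicontinuous F
  modulus_nonneg : 0 ≤ Lg
  lipschitz : SetValuedLipschitz Lg (contributions g)

/-- `M = sup_Z ‖g‖`. -/
def constM {F : X → Set Y} (g : graph F → H) : ℝ := ⨆ z, ‖g z‖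

/-- `C = sup ‖∇ f (∫_Z g dμ)‖` over all probability measures `μ` on `Z`. -/
def constC {F : X → Set Y} (g : graph F → H) (f : H → ℝ) : ℝ :=
  ⨆ μ : ProbabilityMeasure (graph F), ‖gradient f (∫ z, g z ∂(μ : Measure (graph F)))‖

/-- The transfer map
`S (x, y, x') = {(x', y') ∈ Z | ‖g (x', y') - g (x, y)‖ ≤ Lg * d(x, x')}`. -/
def transfer {F : X → Set Y} (g : graph F → H) (Lg : ℝ) (p : graph F × X) : Set (graph F) :=
  {z | z.1.1 = p.2 ∧ ‖g z - g p.1‖ ≤ Lg * dist p.1.1.1 p.2}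

/-- `μ₁` is an output of the bridging method with input `m₀, m₁, μ₀`: take an optimal coupling `ρ`
of `m₀, m₁`, a probability measure `ν` on `Z × X` that glues `μ₀` and `ρ`, a Borel selection `s`
of the transfer map, and push `ν` forward by `s`. -/
def IsBridgingOutput {F : X → Set Y} (g : graph F → H) (Lg : ℝ) (m₀ m₁ : Measure X)
    (μ₀ μ₁ : Measure (graph F)) : Prop :=
  ∃ (ρ : Measure (X × X)) (ν : Measure (graph F × X)) (s : graph F × X → graph F),
    IsOptimalCoupling m₀ m₁ ρ ∧
    IsProbabilityMeasure ν ∧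
    ν.map Prod.fst = μ₀ ∧
    ν.map (fun p => (p.1.1.1, p.2)) = ρ ∧
    Measurable s ∧
    (∀ p, s p ∈ transfer g Lg p) ∧
    μ₁ = ν.map s

end Problem

end MFO

end

/-! Transport the mass of `μ₀` along an optimal coupling of `m₀` and `m₁`: a particle `(x, y)` sent
to `x'` picks `y'` with `‖g (x', y') - g (x, y)‖ ≤ Lg * d(x, x')`, so the aggregate `∫ g` moves by
at most `Lg` times the transport cost, which Kantorovich–Rubinstein duality bounds by `krDist`
(`IsBridgingOutput.norm_integral_sub_le`). Convexity gives `f b - f a ≤ ⟪∇f b, b - a⟫`; with `b` the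
new aggregate the gradient is bounded by `constC`, so the cost rises by at most `Lg * (C + L * M) *
krDist` (`IsBridgingOutput.cost_le`). Infima over `μ₀` and the symmetry of `krDist` compare the
values; adding the two estimates yields the factor 2.

The rest makes the method executable. Optimal couplings exist by Prokhorov compactness, gluing is
disintegration, and the Borel selection minimises lexicographically the distances to a dense
sequence. Duality is proved on finite sets by separating convex sets, then carried to `X` by
quantising both measures with one simple function and lifting the discrete coupling. -/

/-! ### Measurable selection from compact-valued maps -/

section Selection

variable {P Z : Type*} [MetricSpace Z]

/-- Iterated minimisation: `lexMin Φ z n p` is the set of points of `Φ p` that lexicographically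
minimise the distances to `z 0, …, z (n - 1)`. -/
def lexMin (Φ : P → Set Z) (z : ℕ → Z) : ℕ → P → Set Z
  | 0, p => Φ p
  | n + 1, p => {y ∈ lexMin Φ z n p | ∀ y' ∈ lexMin Φ z n p, dist y (z n) ≤ dist y' (z n)}

lemma lexMin_succ_subset (Φ : P → Set Z) (z : ℕ → Z) (n : ℕ) (p : P) :
    lexMin Φ z (n + 1) p ⊆ lexMin Φ z n p := fun _ hy => hy.1

lemma isCompact_lexMin {Φ : P → Set Z} (hc : ∀ p, IsCompact (Φ p)) (z : ℕ → Z) (n : ℕ) (p : P) :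
    IsCompact (lexMin Φ z n p) := by
  induction n with
  | zero => exact hc p
  | succ n ih =>
    have : lexMin Φ z (n + 1) p =
        lexMin Φ z n p ∩ ⋂ y' ∈ lexMin Φ z n p, {y | dist y (z n) ≤ dist y' (z n)} := by
      ext y; simp [lexMin]
    rw [this]
    refine ih.inter_right (isClosed_biInter fun y' _ => ?_)
    exact isClosed_le (by fun_prop) (by fun_prop)

lemma lexMin_nonempty {Φ : P → Set Z} (hc : ∀ p, IsCompact (Φ p)) (hn : ∀ p, (Φ p).Nonempty)
    (z : ℕ → Z) (n : ℕ) (p : P) : (lexMin Φ z n p).Nonempty := by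
  induction n with
  | zero => exact hn p
  | succ n ih =>
    obtain ⟨y, hy, hmin⟩ := (isCompact_lexMin hc z n p).exists_isMinOn ih
      (f := fun y => dist y (z n)) (by fun_prop)
    exact ⟨y, hy, fun y' hy' => hmin hy'⟩

/-- By compactness, `A` meets stage `n + 1` iff it meets stage `n` and the minimal distance to `z n`
over stage `n` is already reached in `A`. Comparing the two minima through rational thresholds
leaves countably many conditions on stage `n`. -/
lemma measurableSet_lexMin_inter_nonempty [MeasurableSpace P] {Φ : P → Set Z}
    (hc : ∀ p, IsCompact (Φ p))
    (hm : ∀ A : Set Z, IsClosed A → MeasurableSet {p | (Φ p ∩ A).Nonempty}) (z : ℕ → Z) (n : ℕ)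
    {A : Set Z} (hA : IsClosed A) : MeasurableSet {p | (lexMin Φ z n p ∩ A).Nonempty} := by
  induction n generalizing A with
  | zero => exact hm A hA
  | succ n ih =>
    have hball (q : ℚ) : IsClosed {y : Z | dist y (z n) ≤ q} :=
      isClosed_le (by fun_prop) (by fun_prop)
    have : {p | (lexMin Φ z (n + 1) p ∩ A).Nonempty} = {p | (lexMin Φ z n p ∩ A).Nonempty} ∩
        ⋂ q : ℚ, ({p | (lexMin Φ z n p ∩ {y | dist y (z n) ≤ q}).Nonempty}ᶜ ∪
          {p | (lexMin Φ z n p ∩ (A ∩ {y | dist y (z n) ≤ q})).Nonempty}) := by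
      ext p
      simp only [mem_inter_iff, mem_iInter, mem_union, mem_compl_iff]
      constructor
      · rintro ⟨y, hy, hyA⟩
        refine ⟨⟨y, hy.1, hyA⟩, fun q => ?_⟩
        rw [or_iff_not_imp_left, not_not]
        rintro ⟨y', hy', hq⟩
        exact ⟨y, hy.1, hyA, (hy.2 y' hy').trans hq⟩
      · rintro ⟨hne, hq⟩
        obtain ⟨y, hy, hmin⟩ := ((isCompact_lexMin hc z n p).inter_right hA).exists_isMinOn hne
          (f := fun y => dist y (z n)) (by fun_prop)
        refine ⟨y, ⟨hy.1, fun y' hy' => ?_⟩, hy.2⟩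
        by_contra! hlt
        obtain ⟨q, hq₁, hq₂⟩ := exists_rat_btwn hlt
        rcases hq q with h | ⟨w, hw, hwA, hwq⟩
        · exact h ⟨y', hy', hq₁.le⟩
        · have h₁ : dist y (z n) ≤ dist w (z n) := hmin ⟨hw, hwA⟩
          have h₂ : dist w (z n) ≤ q := hwq
          linarith
    rw [this]
    exact (ih hA).inter (MeasurableSet.iInter fun q =>
      (ih (hball q)).compl.union (ih (hA.inter (hball q))))

/-- **Measurable selection** for compact-valued maps: if `Φ` has nonempty compact values and
`{p | Φ p ∩ A ≠ ∅}` is measurable for all closed `A`, then `Φ` has a measurable selection. -/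
theorem exists_measurable_selection [MeasurableSpace P] [SecondCountableTopology Z]
    [MeasurableSpace Z] [BorelSpace Z] {Φ : P → Set Z} (hc : ∀ p, IsCompact (Φ p))
    (hn : ∀ p, (Φ p).Nonempty)
    (hm : ∀ A : Set Z, IsClosed A → MeasurableSet {p | (Φ p ∩ A).Nonempty}) :
    ∃ s : P → Z, Measurable s ∧ ∀ p, s p ∈ Φ p := by
  rcases isEmpty_or_nonempty P with hP | ⟨⟨p₀⟩⟩
  · exact ⟨fun p => isEmptyElim p, measurable_of_empty _, fun p => isEmptyElim p⟩
  have : Nonempty Z := (hn p₀).to_type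
  let z := TopologicalSpace.denseSeq Z
  have hz : DenseRange z := TopologicalSpace.denseRange_denseSeq Z
  -- Cantor's intersection theorem: a closed set that meets every stage meets their intersection.
  have key (p : P) (A : Set Z) (hA : IsClosed A)
      (h : ∀ n, (lexMin Φ z n p ∩ A).Nonempty) : (⋂ n, lexMin Φ z n p ∩ A).Nonempty :=
    IsCompact.nonempty_iInter_of_sequence_nonempty_isCompact_isClosed _
      (fun n => inter_subset_inter_left _ (lexMin_succ_subset Φ z n p)) h
      ((isCompact_lexMin hc z 0 p).inter_right hA)
      (fun n => (isCompact_lexMin hc z n p).isClosed.inter hA)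
  have hne (p : P) : (⋂ n, lexMin Φ z n p).Nonempty := by
    simpa using key p univ isClosed_univ fun n => by simpa using lexMin_nonempty hc hn z n p
  -- Two points surviving all stages are equidistant from each point of a dense sequence, hence
  -- equal.
  have huniq (p : P) (y y' : Z) (hy : y ∈ ⋂ n, lexMin Φ z n p)
      (hy' : y' ∈ ⋂ n, lexMin Φ z n p) : y = y' := by
    rw [mem_iInter] at hy hy'
    have h (n : ℕ) : dist y (z n) = dist y' (z n) :=
      le_antisymm ((hy (n + 1)).2 _ (hy' n)) ((hy' (n + 1)).2 _ (hy n))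
    have h' : (fun w => dist y w) = fun w => dist y' w :=
      hz.equalizer (by fun_prop) (by fun_prop) (funext h)
    have := congrFun h' y'
    simpa using this
  choose s hs using hne
  refine ⟨s, measurable_of_isClosed fun A hA => ?_, fun p => mem_iInter.1 (hs p) 0⟩
  have : s ⁻¹' A = ⋂ n, {p | (lexMin Φ z n p ∩ A).Nonempty} := by
    ext p
    simp only [mem_preimage, mem_iInter]
    constructor
    · exact fun h n => ⟨s p, mem_iInter.1 (hs p) n, h⟩
    · intro h
      obtain ⟨y, hy⟩ := key p A hA h
      rw [mem_iInter] at hy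
      rw [huniq p (s p) y (hs p) (mem_iInter.2 fun n => (hy n).1)]
      exact (hy 0).2
  rw [this]
  exact MeasurableSet.iInter fun n => measurableSet_lexMin_inter_nonempty hc hm z n hA

end Selection

/-! ### Gluing by disintegration -/

section Gluing

open ProbabilityTheory

/-- **Gluing**: a measure `μ` on `α` and a measure `ρ` on `β × γ` whose first marginal is the image
of `μ` under `h : α → β` are the images of a common measure on `α × γ`. -/
theorem exists_gluing {α β γ : Type*} [MeasurableSpace α] [MeasurableSpace β] [MeasurableSpace γ]
    [StandardBorelSpace γ] [Nonempty γ] (μ : Measure α) [IsProbabilityMeasure μ]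
    (ρ : Measure (β × γ)) [IsProbabilityMeasure ρ] {h : α → β} (hh : Measurable h)
    (hρ : ρ.map Prod.fst = μ.map h) :
    ∃ ν : Measure (α × γ), IsProbabilityMeasure ν ∧ ν.map Prod.fst = μ ∧
      ν.map (fun p => (h p.1, p.2)) = ρ := by
  -- Given `a`, the second coordinate is drawn from the conditional law of `ρ` at `h a`.
  refine ⟨μ ⊗ₘ (ρ.condKernel.comap h hh), inferInstance, Measure.fst_compProd _ _, ?_⟩
  have hmeas : Measurable fun p : α × γ => (h p.1, p.2) := by fun_prop
  conv_rhs => rw [← ρ.disintegrate ρ.condKernel]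
  ext A hA
  rw [Measure.map_apply hmeas hA, Measure.compProd_apply (hmeas hA), Measure.compProd_apply hA,
    Measure.fst, hρ, lintegral_map (Kernel.measurable_kernel_prodMk_left hA) hh]
  rfl

end Gluing

namespace MFO

/-! ### Properness of the projection of the graph, and the selections it yields -/

section Projection

variable {X Y H : Type*} [MetricSpace X] [MetricSpace Y] [NormedAddCommGroup H] {F : X → Set Y}

/-- The projection of the graph of a compact-valued upper hemicontinuous map is proper. -/
lemma isProperMap_graph_fst (hF : IsClosed (graph F)) (hc : ∀ x, IsCompact (F x))
    (hu : UpperHemicontinuous F) : IsProperMap fun z : graph F => z.1.1 := by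
  rw [isProperMap_iff_isClosedMap_and_compact_fibers]
  refine ⟨by fun_prop, fun A hA => ?_, fun x => ?_⟩
  · rw [← isOpen_compl_iff, isOpen_iff_mem_nhds]
    intro x hx
    have hA' : IsClosed (Subtype.val '' A) := hF.isClosedMap_subtype_val A hA
    -- The compact fibre over `x` misses `A`, hence so does a tube `u × v` around it; upper
    -- hemicontinuity keeps `F x'` inside `v` for `x'` near `x`.
    obtain ⟨u, v, hu', hv, hxu, hFv, huv⟩ := generalized_tube_lemma (isCompact_singleton (x := x))
      (hc x) hA'.isOpen_compl (by
        rintro ⟨a, b⟩ ⟨ha, hb⟩ ⟨z, hz, hzab⟩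
        refine hx ⟨z, hz, ?_⟩
        rw [mem_singleton_iff] at ha
        simp [hzab, ha])
    filter_upwards [hu'.mem_nhds (hxu rfl), hu.forall_isOpen x v hv hFv] with x' hx'u hx'v
    rintro ⟨z, hz, rfl⟩
    exact huv ⟨hx'u, hx'v z.2⟩ ⟨z, hz, rfl⟩
  · rw [Topology.IsEmbedding.subtypeVal.isCompact_iff]
    convert! (hc x).image (f := fun y => (x, y)) (by fun_prop) using 1
    ext ⟨a, b⟩
    simp only [graph, mem_image, Subtype.exists, Prod.mk.injEq]
    constructor
    · rintro ⟨w, hw, hwx, rfl⟩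
      obtain rfl : a = x := hwx
      exact ⟨b, hw, rfl, rfl⟩
    · rintro ⟨y, hy, rfl, rfl⟩
      exact ⟨(x, y), hy, rfl, rfl⟩

variable [MeasurableSpace X] [BorelSpace X] [SecondCountableTopology X]
  [MeasurableSpace Y] [BorelSpace Y] [SecondCountableTopology Y]

/-- A closed-graph, compact-valued, upper hemicontinuous map has a Borel selection. -/
lemma exists_measurable_section (hF : IsClosed (graph F)) (hn : ∀ x, (F x).Nonempty)
    (hc : ∀ x, IsCompact (F x)) (hu : UpperHemicontinuous F) :
    ∃ s : X → graph F, Measurable s ∧ ∀ x, (s x).1.1 = x := by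
  have hp := isProperMap_graph_fst hF hc hu
  refine exists_measurable_selection (Φ := fun x => {z : graph F | z.1.1 = x})
    (fun x => hp.isCompact_preimage isCompact_singleton)
    (fun x => ⟨⟨(x, (hn x).some), (hn x).some_mem⟩, rfl⟩) fun A hA => ?_
  convert! (hp.isClosedMap A hA).measurableSet using 1
  ext x
  exact ⟨fun ⟨z, hz, hzA⟩ => ⟨z, hzA, hz⟩, fun ⟨z, hzA, hz⟩ => ⟨z, hz, hzA⟩⟩

/-- The transfer map has a Borel selection. -/
lemma exists_measurable_transfer {g : graph F → H} {Lg : ℝ} (hF : IsClosed (graph F))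
    (hstab : StabilityAssumption g Lg) :
    ∃ s : graph F × X → graph F, Measurable s ∧ ∀ p, s p ∈ transfer g Lg p := by
  have hg := hstab.continuous
  have hp := isProperMap_graph_fst hF hstab.compact hstab.usc
  refine exists_measurable_selection (fun p => ?_) (fun p => ?_) fun A hA => ?_
  · refine (hp.isCompact_preimage (isCompact_singleton (x := p.2))).of_isClosed_subset ?_
      fun z hz => hz.1
    have h₁ : IsClosed {z : graph F | z.1.1 = p.2} := isClosed_eq (by fun_prop) (by fun_prop)
    have h₂ : IsClosed {z : graph F | ‖g z - g p.1‖ ≤ Lg * dist p.1.1.1 p.2} :=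
      isClosed_le (by fun_prop) (by fun_prop)
    exact h₁.inter h₂
  · obtain ⟨⟨⟨x, y⟩, hy⟩, x'⟩ := p
    obtain ⟨_, ⟨y', hy', rfl⟩, b, hb, hab⟩ := hstab.lipschitz x x' ⟨y, hy, rfl⟩
    refine ⟨⟨(x', y'), hy'⟩, rfl, ?_⟩
    have hab' : g ⟨(x', y'), hy'⟩ + b = g ⟨(x, y), hy⟩ := hab
    rw [← hab', sub_add_cancel_left, norm_neg]
    simpa using hb
  · have hle : IsClosed {q : graph F × graph F | ‖g q.2 - g q.1‖ ≤ Lg * dist q.1.1.1 q.2.1.1} :=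
      isClosed_le (by fun_prop) (by fun_prop)
    have hclosed : IsClosed {q : graph F × graph F | q.2 ∈ A ∧
        ‖g q.2 - g q.1‖ ≤ Lg * dist q.1.1.1 q.2.1.1} :=
      (hA.preimage continuous_snd).inter hle
    -- A product of proper maps is proper, so the points `p` whose transfer set meets `A` form a
    -- closed set.
    convert! ((isProperMap_id.prodMap hp).isClosedMap _ hclosed).measurableSet using 1
    ext ⟨w, x'⟩
    constructor
    · rintro ⟨z, ⟨hz, hle⟩, hzA⟩
      obtain rfl : z.1.1 = x' := hz
      exact ⟨(w, z), ⟨hzA, hle⟩, rfl⟩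
    · rintro ⟨⟨w', z⟩, ⟨hzA, hle⟩, heq⟩
      obtain ⟨rfl, rfl⟩ := Prod.mk.inj heq
      exact ⟨z, ⟨rfl, hle⟩, hzA⟩

end Projection

end MFO

/-! ### Finite Kantorovich duality by Hahn–Banach separation -/

section Finite

/-- **Kantorovich duality** on a finite set. -/
theorem exists_finite_coupling {ι : Type*} [Fintype ι] {p q : ι → ℝ}
    (hp : p ∈ stdSimplex ℝ ι) (hq : q ∈ stdSimplex ℝ ι) (c : ι → ι → ℝ) (r : ℝ)
    (h : ∀ φ ψ : ι → ℝ, (∀ i j, φ i + ψ j ≤ c i j) → ∑ i, φ i * p i + ∑ j, ψ j * q j ≤ r) :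
    ∃ w : ι → ι → ℝ, (∀ i j, 0 ≤ w i j) ∧ (∀ i, ∑ j, w i j = p i) ∧ (∀ j, ∑ i, w i j = q j) ∧
      ∑ i, ∑ j, w i j * c i j ≤ r := by
  classical
  by_contra hcon
  -- `A` records both marginals and the cost. If no coupling costs at most `r`, the compact convex
  -- image of the simplex misses the closed convex set `{p} × {q} × (-∞, r]`.
  let A : (ι × ι → ℝ) →ₗ[ℝ] (ι → ℝ) × (ι → ℝ) × ℝ :=
    { toFun := fun w => (fun i => ∑ j, w (i, j), fun j => ∑ i, w (i, j),
        ∑ i, ∑ j, w (i, j) * c i j)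
      map_add' := fun w w' => by
        ext <;> simp [Finset.sum_add_distrib, add_mul]
      map_smul' := fun a w => by
        ext <;> simp [Finset.mul_sum, mul_assoc] }
  have hA : Continuous A := A.continuous_on_pi
  let t : Set ((ι → ℝ) × (ι → ℝ) × ℝ) := {p} ×ˢ {q} ×ˢ Iic r
  have hdisj : Disjoint (A '' stdSimplex ℝ (ι × ι)) t := by
    rw [Set.disjoint_left]
    rintro _ ⟨w, hw, rfl⟩ ⟨h₁, h₂, h₃⟩
    exact hcon ⟨fun i j => w (i, j), fun i j => hw.1 _, fun i => congrFun h₁ i,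
      fun j => congrFun h₂ j, h₃⟩
  obtain ⟨f, u, v, hu, huv, hv⟩ := geometric_hahn_banach_compact_closed
    ((convex_stdSimplex ℝ _).linear_image A) ((isCompact_stdSimplex ℝ _).image hA)
    ((convex_singleton p).prod ((convex_singleton q).prod (convex_Iic r)))
    (isClosed_singleton.prod (isClosed_singleton.prod isClosed_Iic)) hdisj
  let a : ι → ℝ := fun i => f (fun j => if i = j then 1 else 0, 0)
  let b : ι → ℝ := fun j => f (0, fun i => if j = i then 1 else 0, 0)
  let k : ℝ := f (0, 0, 1)
  have hf (x y : ι → ℝ) (z : ℝ) : f (x, y, z) = ∑ i, a i * x i + ∑ j, b j * y j + k * z := by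
    have hx : f (x, 0) = ∑ i, a i * x i := by
      have := LinearMap.pi_apply_eq_sum_univ
        (f.toLinearMap ∘ₗ LinearMap.inl ℝ (ι → ℝ) ((ι → ℝ) × ℝ)) x
      simpa [a, mul_comm] using this
    have hy : f (0, y, 0) = ∑ j, b j * y j := by
      have := LinearMap.pi_apply_eq_sum_univ
        (f.toLinearMap ∘ₗ LinearMap.inr ℝ (ι → ℝ) ((ι → ℝ) × ℝ) ∘ₗ LinearMap.inl ℝ (ι → ℝ) ℝ) y
      simpa [b, mul_comm] using this
    have hz : f (0, 0, z) = k * z := by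
      have : ((0, 0, z) : (ι → ℝ) × (ι → ℝ) × ℝ) = z • (0, 0, 1) := by simp
      rw [this, map_smul, smul_eq_mul, mul_comm]
    rw [← hx, ← hy, ← hz, ← map_add, ← map_add]
    simp
  have hvertex (i j : ι) : a i + b j + k * c i j < u := by
    have := hu _ ⟨Pi.single (i, j) 1, single_mem_stdSimplex ℝ (i, j), rfl⟩
    have e : A (Pi.single (i, j) 1) = (Pi.single i 1, Pi.single j 1, c i j) := by
      ext x
      · by_cases hx : x = i <;> simp [A, Pi.single_apply, hx, -Finset.sum_boole]
      · by_cases hx : x = j <;> simp [A, Pi.single_apply, hx, -Finset.sum_boole]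
      · simp [A, Pi.single_apply, ite_and, Finset.sum_ite_irrel]
    rw [e, hf] at this
    simpa [Pi.single_apply] using this
  -- The product coupling gives a point of the image with the marginals `p` and `q`; it serves to
  -- show `k < 0`.
  have hpq : f (p, q, ∑ i, ∑ j, p i * q j * c i j) < u := by
    refine hu _ ⟨fun x => p x.1 * q x.2, ⟨fun x => mul_nonneg (hp.1 _) (hq.1 _), ?_⟩, ?_⟩
    · rw [Fintype.sum_prod_type]
      simp [← Finset.mul_sum, hp.2, hq.2]
    · simp only [A, LinearMap.coe_mk, AddHom.coe_mk]
      simp [← Finset.mul_sum, ← Finset.sum_mul, hp.2, hq.2]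
  have hr (z : ℝ) (hz : z ≤ r) : v < f (p, q, z) := hv _ ⟨rfl, rfl, hz⟩
  rw [hf] at hpq
  simp only [hf] at hr
  set S := ∑ i, a i * p i + ∑ j, b j * q j
  set D := ∑ i, ∑ j, p i * q j * c i j
  have hk : k < 0 := by
    by_contra! hk
    have := hr (min r D) (min_le_left _ _)
    have := mul_le_mul_of_nonneg_left (min_le_right r D) hk
    linarith
  -- Dividing the vertex inequalities by `-k > 0` gives dual feasible potentials; the constant `u`
  -- goes into the first one, where it survives summation because `p` has total mass 1.
  have hdual := h (fun i => (a i - u) / (-k)) (fun j => b j / (-k)) fun i j => by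
    rw [← add_div, div_le_iff₀ (by linarith)]
    linarith [hvertex i j]
  have hsum : ∑ i, (a i - u) / (-k) * p i + ∑ j, b j / (-k) * q j = (S - u) / (-k) := by
    have h₁ : ∑ i, (a i - u) / (-k) * p i = (∑ i, a i * p i - u) / (-k) := by
      simp_rw [div_mul_eq_mul_div, sub_mul]
      rw [← Finset.sum_div, Finset.sum_sub_distrib, ← Finset.mul_sum, hp.2, mul_one]
    have h₂ : ∑ j, b j / (-k) * q j = (∑ j, b j * q j) / (-k) := by
      simp_rw [div_mul_eq_mul_div]
      rw [← Finset.sum_div]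
    rw [h₁, h₂, ← add_div]
    congr 1
    ring
  rw [hsum, div_le_iff₀ (by linarith)] at hdual
  linarith [hr r le_rfl]

end Finite

/-! ### Existence of optimal couplings -/

section Optimal

open Filter Topology

variable {X : Type*} [MetricSpace X] [MeasurableSpace X] [BorelSpace X]
  [SecondCountableTopology X]

/-- The transport cost is lower semicontinuous for the convergence in distribution. -/
lemma lowerSemicontinuous_lintegral_edist :
    LowerSemicontinuous fun ρ : ProbabilityMeasure (X × X) =>
      ∫⁻ p, edist p.1 p.2 ∂(ρ : Measure (X × X)) := by
  -- The truncations `min d n` are bounded and continuous, so their integrals are weakly continuous;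
  -- the cost is their supremum by monotone convergence.
  have hcont (n : ℕ) : Continuous fun ρ : ProbabilityMeasure (X × X) =>
      ∫⁻ p, ((min (nndist p.1 p.2) n : ℝ≥0) : ℝ≥0∞) ∂(ρ : Measure (X × X)) := by
    let φ : BoundedContinuousFunction (X × X) ℝ≥0 :=
      BoundedContinuousFunction.mkOfBound ⟨fun p => min (nndist p.1 p.2) n, by fun_prop⟩ n
        (fun p q => by
          simp only [ContinuousMap.coe_mk, NNReal.dist_eq]
          rw [abs_le]
          have h₁ : ((min (nndist p.1 p.2) n : ℝ≥0) : ℝ) ≤ n := by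
            exact_mod_cast min_le_right _ _
          have h₂ : ((min (nndist q.1 q.2) n : ℝ≥0) : ℝ) ≤ n := by
            exact_mod_cast min_le_right _ _
          have h₃ := (min (nndist p.1 p.2) (n : ℝ≥0)).2
          have h₄ := (min (nndist q.1 q.2) (n : ℝ≥0)).2
          simp only [NNReal.val_eq_coe] at h₃ h₄
          constructor <;> push_cast at * <;> linarith)
    rw [continuous_iff_continuousAt]
    intro ρ
    exact (ProbabilityMeasure.tendsto_iff_forall_lintegral_tendsto.1 tendsto_id) φ
  have heq : (fun ρ : ProbabilityMeasure (X × X) => ∫⁻ p, edist p.1 p.2 ∂(ρ : Measure (X × X))) =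
      fun ρ : ProbabilityMeasure (X × X) =>
        ⨆ n : ℕ, ∫⁻ p, ((min (nndist p.1 p.2) n : ℝ≥0) : ℝ≥0∞) ∂(ρ : Measure (X × X)) := by
    ext ρ
    rw [← lintegral_iSup (fun n => by fun_prop)
      (fun m n hmn p => by
        simp only [ENNReal.coe_le_coe]
        exact min_le_min le_rfl (by exact_mod_cast hmn))]
    refine lintegral_congr fun p => ?_
    rw [edist_nndist]
    refine le_antisymm ?_ (iSup_le fun n => by simp)
    obtain ⟨n, hn⟩ := exists_nat_ge (nndist p.1 p.2)
    refine le_iSup_of_le n ?_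
    rw [min_eq_left hn]
  rw [heq]
  exact lowerSemicontinuous_iSup fun n => (hcont n).lowerSemicontinuous

/-- Optimal couplings exist. -/
theorem exists_isOptimalCoupling [CompleteSpace X] (m₀ m₁ : Measure X) [IsProbabilityMeasure m₀]
    [IsProbabilityMeasure m₁] : ∃ ρ, MFO.IsOptimalCoupling m₀ m₁ ρ := by
  let K : Set (ProbabilityMeasure (X × X)) := {ρ | (ρ : Measure (X × X)) ∈ MFO.couplings m₀ m₁}
  have hclosed : IsClosed K := by
    have : K = {ρ | ρ.map (f := Prod.fst) (by fun_prop) = ⟨m₀, inferInstance⟩} ∩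
        {ρ | ρ.map (f := Prod.snd) (by fun_prop) = ⟨m₁, inferInstance⟩} := by
      ext ρ
      exact ⟨fun h => ⟨Subtype.ext h.2.1, Subtype.ext h.2.2⟩,
        fun h => ⟨inferInstance, congrArg Subtype.val h.1, congrArg Subtype.val h.2⟩⟩
    rw [this]
    exact (isClosed_eq (ProbabilityMeasure.continuous_map continuous_fst) continuous_const).inter
      (isClosed_eq (ProbabilityMeasure.continuous_map continuous_snd) continuous_const)
  -- The marginals are fixed, and a single probability measure on a Polish space is tight.
  have htight :
      IsTightMeasureSet {((μ : ProbabilityMeasure (X × X)) : Measure (X × X)) | μ ∈ K} := by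
    refine IsTightMeasureSet.prodMk ((isTightMeasureSet_singleton (μ := m₀)).subset ?_)
      ((isTightMeasureSet_singleton (μ := m₁)).subset ?_)
    · rintro _ ⟨_, ⟨ρ, hρ, rfl⟩, rfl⟩
      exact hρ.2.1
    · rintro _ ⟨_, ⟨ρ, hρ, rfl⟩, rfl⟩
      exact hρ.2.2
  have hcompact : IsCompact K := by
    simpa [hclosed.closure_eq] using isCompact_closure_of_isTightMeasureSet htight
  have hne : K.Nonempty :=
    ⟨⟨m₀.prod m₁, inferInstance⟩, (inferInstance : IsProbabilityMeasure (m₀.prod m₁)),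
      Measure.fst_prod, Measure.snd_prod⟩
  obtain ⟨ρ, hρ, hmin⟩ := LowerSemicontinuousOn.exists_isMinOn hne hcompact
    (lowerSemicontinuous_lintegral_edist.lowerSemicontinuousOn K)
  exact ⟨ρ, hρ, fun ρ' hρ' => hmin (a := ⟨ρ', hρ'.1⟩) hρ'⟩

end Optimal

/-! ### Images of measures under simple functions -/

section SimpleFunc

variable {α β : Type*} [MeasurableSpace α] [MeasurableSpace β]

/-- The image of a measure under a simple function is a finite sum of Dirac masses. -/
lemma MeasureTheory.SimpleFunc.map_measure_eq_sum_dirac [MeasurableSingletonClass β]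
    (T : SimpleFunc α β) (m : Measure α) :
    m.map T = ∑ i : T.range, m (T ⁻¹' {i.1}) • Measure.dirac i.1 := by
  have hT : Measurable T := T.measurable
  ext A hA
  have h := SimpleFunc.map_lintegral (μ := m) (A.indicator 1) T
  rw [← SimpleFunc.lintegral_eq_lintegral] at h
  have h' : ∫⁻ x, (T.map (A.indicator (1 : β → ℝ≥0∞))) x ∂m = m (T ⁻¹' A) := by
    rw [← lintegral_indicator_one (hT hA)]
    rfl
  rw [Measure.map_apply hT hA, ← h', h, Finset.sum_coe_sort T.range
    (fun i => m (T ⁻¹' {i}) • Measure.dirac i)]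
  simp [Measure.finsetSum_apply, hA, mul_comm]

lemma MeasureTheory.SimpleFunc.integral_comp_eq_sum [MeasurableSingletonClass β] (T : SimpleFunc α β)
    (m : Measure α) [IsFiniteMeasure m] {φ : β → ℝ} (hφ : Measurable φ) :
    ∫ x, φ (T x) ∂m = ∑ i : T.range, φ i.1 * m.real (T ⁻¹' {i.1}) := by
  rw [← integral_map (f := φ) T.measurable.aemeasurable hφ.aestronglyMeasurable,
    T.map_measure_eq_sum_dirac, integral_finsetSum_measure]
  · simp [integral_smul_measure, integral_dirac' _ _ hφ.stronglyMeasurable, Measure.real, mul_comm]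
  · intro i _
    refine Integrable.smul_measure ?_ (measure_ne_top _ _)
    exact integrable_dirac' hφ.stronglyMeasurable (by simp)

end SimpleFunc

namespace MFO

/-! ### Kantorovich–Rubinstein duality by quantisation -/

section KantorovichRubinstein

open Filter Topology

variable {X : Type*} [MetricSpace X] [MeasurableSpace X]

lemma krDist_comm (m₀ m₁ : Measure X) : krDist m₀ m₁ = krDist m₁ m₀ := by
  let e : {φ : X → ℝ // LipschitzWith 1 φ} ≃ {φ : X → ℝ // LipschitzWith 1 φ} :=
    { toFun := fun φ => ⟨fun x => -φ.1 x, φ.2.neg⟩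
      invFun := fun φ => ⟨fun x => -φ.1 x, φ.2.neg⟩
      left_inv := fun φ => by simp
      right_inv := fun φ => by simp }
  refine e.iSup_congr fun φ => ?_
  simp only [e, Equiv.coe_fn_mk, integral_neg]
  ring

variable [BorelSpace X]

lemma FiniteFirstMoment.integrable_of_lipschitz {m : Measure X} (hm : FiniteFirstMoment m)
    {φ : X → ℝ} (hφ : LipschitzWith 1 φ) : Integrable φ m := by
  obtain ⟨_, x₀, hx₀⟩ := hm
  refine ((integrable_const |φ x₀|).add hx₀).mono' hφ.continuous.measurable.aestronglyMeasurable
    (.of_forall fun x => ?_)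
  have := hφ.dist_le_mul x x₀
  rw [Real.dist_eq, NNReal.coe_one, one_mul] at this
  rw [Real.norm_eq_abs, Pi.add_apply]
  have := abs_sub_abs_le_abs_sub (φ x) (φ x₀)
  linarith

lemma FiniteFirstMoment.lintegral_edist_ne_top {m : Measure X} (hm : FiniteFirstMoment m) (y : X) :
    ∫⁻ x, edist x y ∂m ≠ ∞ := by
  have h := (hm.integrable_of_lipschitz (LipschitzWith.dist_left y)).lintegral_lt_top
  simpa [edist_dist] using h.ne

variable {m₀ m₁ : Measure X}

/-- A real supremum is meaningful only if bounded. Subtracting `φ x₀` changes nothing since both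
masses are 1, and `|φ - φ x₀| ≤ dist · x₀`. -/
lemma bddAbove_krDist (hm₀ : FiniteFirstMoment m₀) (hm₁ : FiniteFirstMoment m₁) :
    BddAbove (range fun φ : {φ : X → ℝ // LipschitzWith 1 φ} =>
      (∫ x, φ.1 x ∂m₀) - ∫ x, φ.1 x ∂m₁) := by
  obtain ⟨hp₀, x₀, hx₀⟩ := id hm₀
  have hp₁ := hm₁.1
  refine ⟨∫ x, dist x x₀ ∂m₀ + ∫ x, dist x x₀ ∂m₁, ?_⟩
  rintro _ ⟨⟨φ, hφ⟩, rfl⟩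
  have hd₁ := hm₁.integrable_of_lipschitz (LipschitzWith.dist_left x₀)
  have hle (x : X) : |φ x - φ x₀| ≤ dist x x₀ := by
    simpa [Real.dist_eq] using hφ.dist_le_mul x x₀
  have h₀ : ∫ x, φ x ∂m₀ ≤ ∫ x, (dist x x₀ + φ x₀) ∂m₀ :=
    integral_mono (hm₀.integrable_of_lipschitz hφ) (hx₀.add (integrable_const _))
      fun x => by linarith [(abs_le.1 (hle x)).2]
  have h₁ : ∫ x, (φ x₀ - dist x x₀) ∂m₁ ≤ ∫ x, φ x ∂m₁ :=
    integral_mono ((integrable_const _).sub hd₁) (hm₁.integrable_of_lipschitz hφ)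
      fun x => by linarith [(abs_le.1 (hle x)).1]
  rw [integral_add hx₀ (integrable_const _)] at h₀
  rw [integral_sub (integrable_const _) hd₁] at h₁
  simp only [integral_const, probReal_univ, one_smul] at h₀ h₁
  show (∫ x, φ x ∂m₀) - ∫ x, φ x ∂m₁ ≤ _
  linarith

lemma le_krDist (hm₀ : FiniteFirstMoment m₀) (hm₁ : FiniteFirstMoment m₁) {φ : X → ℝ}
    (hφ : LipschitzWith 1 φ) : (∫ x, φ x ∂m₀) - ∫ x, φ x ∂m₁ ≤ krDist m₀ m₁ :=
  le_ciSup (bddAbove_krDist hm₀ hm₁) ⟨φ, hφ⟩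

lemma krDist_nonneg (hm₀ : FiniteFirstMoment m₀) (hm₁ : FiniteFirstMoment m₁) :
    0 ≤ krDist m₀ m₁ := by
  simpa using le_krDist hm₀ hm₁ (LipschitzWith.const' (0 : ℝ))

lemma abs_integral_comp_simpleFunc_sub_le {m : Measure X} (hm : FiniteFirstMoment m)
    {φ : X → ℝ} (hφ : LipschitzWith 1 φ) (T : SimpleFunc X X) {ε : ℝ} (hε : 0 ≤ ε)
    (hT : ∫⁻ x, edist x (T x) ∂m ≤ ENNReal.ofReal ε) :
    |(∫ x, φ (T x) ∂m) - ∫ x, φ x ∂m| ≤ ε := by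
  have := hm.1
  have hint : Integrable (fun x => φ (T x)) m := (T.map φ).integrable_of_isFiniteMeasure
  rw [← integral_sub hint (hm.integrable_of_lipschitz hφ), ← Real.norm_eq_abs]
  refine (norm_integral_le_lintegral_norm _).trans (ENNReal.toReal_le_of_le_ofReal hε ?_)
  refine le_trans (lintegral_mono fun x => ?_) hT
  rw [edist_comm, edist_dist]
  refine ENNReal.ofReal_le_ofReal ?_
  simpa [Real.dist_eq] using hφ.dist_le_mul (T x) x

variable [SecondCountableTopology X]

/-- Dominated convergence: `e 0` is always among the candidates, so the distance to the nearest one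
is at most `edist x (e 0)`. -/
lemma tendsto_lintegral_edist_nearestPt {m : Measure X} (hm : FiniteFirstMoment m) {e : ℕ → X}
    (he : DenseRange e) :
    Tendsto (fun n => ∫⁻ x, edist x (SimpleFunc.nearestPt e n x) ∂m) atTop (𝓝 0) := by
  have h := tendsto_lintegral_of_dominated_convergence (μ := m)
    (F := fun n x => edist x (SimpleFunc.nearestPt e n x)) (f := fun _ => 0)
    (fun x => edist x (e 0))
    (fun n => measurable_id.edist (SimpleFunc.measurable _))
    (fun n => .of_forall fun x => by
      simpa [edist_comm] using SimpleFunc.edist_nearestPt_le e x (Nat.zero_le n))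
    (hm.lintegral_edist_ne_top (e 0))
    (.of_forall fun x => by
      have := (SimpleFunc.tendsto_nearestPt (e := e) (x := x) (he x))
      simpa using (tendsto_const_nhds (x := x)).edist this)
  simpa using h

lemma exists_simpleFunc_lintegral_edist_le (hm₀ : FiniteFirstMoment m₀)
    (hm₁ : FiniteFirstMoment m₁) {ε : ℝ} (hε : 0 < ε) :
    ∃ T : SimpleFunc X X, ∫⁻ x, edist x (T x) ∂m₀ ≤ ENNReal.ofReal ε ∧
      ∫⁻ x, edist x (T x) ∂m₁ ≤ ENNReal.ofReal ε := by
  obtain ⟨x₀, -⟩ := hm₀.2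
  have : Nonempty X := ⟨x₀⟩
  have he := TopologicalSpace.denseRange_denseSeq X
  have hε' : (0 : ℝ≥0∞) < ENNReal.ofReal ε := by simpa using hε
  obtain ⟨n, h₀, h₁⟩ := (((tendsto_lintegral_edist_nearestPt hm₀ he).eventually_le_const hε').and
    ((tendsto_lintegral_edist_nearestPt hm₁ he).eventually_le_const hε')).exists
  exact ⟨_, h₀, h₁⟩

/-- Discrete Kantorovich–Rubinstein duality for the images under a simple function. -/
lemma exists_coupling_map_simpleFunc (hm₀ : FiniteFirstMoment m₀) (hm₁ : FiniteFirstMoment m₁)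
    (T : SimpleFunc X X) {ε : ℝ} (hε : 0 ≤ ε) (h₀ : ∫⁻ x, edist x (T x) ∂m₀ ≤ ENNReal.ofReal ε)
    (h₁ : ∫⁻ x, edist x (T x) ∂m₁ ≤ ENNReal.ofReal ε) :
    ∃ σ ∈ couplings (m₀.map T) (m₁.map T),
      ∫⁻ p, edist p.1 p.2 ∂σ ≤ ENNReal.ofReal (krDist m₀ m₁ + 2 * ε) := by
  have hp₀ := hm₀.1
  have hp₁ := hm₁.1
  obtain ⟨x₀, -⟩ := hm₀.2
  have : Nonempty T.range := ⟨⟨T x₀, T.mem_range_self x₀⟩⟩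
  have hsimplex (m : Measure X) [IsProbabilityMeasure m] :
      (fun i : T.range => m.real (T ⁻¹' {i.1})) ∈ stdSimplex ℝ T.range := by
    refine ⟨fun i => measureReal_nonneg, ?_⟩
    have := T.integral_comp_eq_sum m (φ := fun _ => 1) measurable_const
    simpa using this.symm
  obtain ⟨w, hw, hw₀, hw₁, hwc⟩ := exists_finite_coupling (hsimplex m₀) (hsimplex m₁)
    (fun i j => dist i.1 j.1) (krDist m₀ m₁ + 2 * ε) fun φ ψ hφψ => by
      -- The `c`-transform of `ψ` is 1-Lipschitz on all of `X`, with `φ ≤ Φ` and `ψ ≤ -Φ` on the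
      -- atoms. It is therefore a competitor in `krDist`; removing `T` from its two integrals costs
      -- `2 * ε`.
      let Φ : X → ℝ := fun x => ⨅ j : T.range, (dist x j.1 - ψ j)
      have hbdd (x : X) : BddBelow (range fun j : T.range => dist x j.1 - ψ j) :=
        (finite_range _).bddBelow
      have hΦ : LipschitzWith 1 Φ := LipschitzWith.of_le_add fun x y => by
        rw [← sub_le_iff_le_add]
        refine le_ciInf fun j => ?_
        have := ciInf_le (hbdd x) j
        have := dist_triangle x y j.1
        linarith
      have hφ (i : T.range) : φ i ≤ Φ i.1 := le_ciInf fun j => by linarith [hφψ i j]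
      have hψ (j : T.range) : ψ j ≤ -Φ j.1 := by
        have := ciInf_le (hbdd j.1) j
        rw [dist_self] at this
        linarith
      have e₀ := abs_le.1 (abs_integral_comp_simpleFunc_sub_le hm₀ hΦ T hε h₀)
      have e₁ := abs_le.1 (abs_integral_comp_simpleFunc_sub_le hm₁ hΦ T hε h₁)
      have hkr := le_krDist hm₀ hm₁ hΦ
      rw [T.integral_comp_eq_sum _ hΦ.continuous.measurable] at e₀ e₁
      have s₀ : ∑ i, φ i * m₀.real (T ⁻¹' {i.1}) ≤ ∑ i : T.range, Φ i.1 * m₀.real (T ⁻¹' {i.1}) :=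
        Finset.sum_le_sum fun i _ => mul_le_mul_of_nonneg_right (hφ i) measureReal_nonneg
      have s₁ : ∑ i, ψ i * m₁.real (T ⁻¹' {i.1}) ≤ ∑ i : T.range, -Φ i.1 * m₁.real (T ⁻¹' {i.1}) :=
        Finset.sum_le_sum fun i _ => mul_le_mul_of_nonneg_right (hψ i) measureReal_nonneg
      simp only [neg_mul, Finset.sum_neg_distrib] at s₁
      linarith
  let σ : Measure (X × X) :=
    ∑ i : T.range, ∑ j : T.range, ENNReal.ofReal (w i j) • Measure.dirac (i.1, j.1)
  have hσ₀ : σ.map Prod.fst = m₀.map T := by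
    rw [T.map_measure_eq_sum_dirac]
    ext A hA
    rw [Measure.map_apply measurable_fst hA]
    simp only [σ, Measure.finsetSum_apply, Measure.smul_apply, smul_eq_mul,
      Measure.dirac_apply' _ hA, Measure.dirac_apply' _ (measurable_fst hA)]
    refine Finset.sum_congr rfl fun i _ => ?_
    have : m₀ (T ⁻¹' {i.1}) = ∑ j, ENNReal.ofReal (w i j) := by
      rw [← ENNReal.ofReal_sum_of_nonneg fun j _ => hw i j, hw₀, ofReal_measureReal]
    rw [this, Finset.sum_mul]
    rfl
  have hσ₁ : σ.map Prod.snd = m₁.map T := by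
    rw [T.map_measure_eq_sum_dirac]
    ext A hA
    rw [Measure.map_apply measurable_snd hA]
    simp only [σ, Measure.finsetSum_apply, Measure.smul_apply, smul_eq_mul,
      Measure.dirac_apply' _ hA, Measure.dirac_apply' _ (measurable_snd hA)]
    rw [Finset.sum_comm]
    refine Finset.sum_congr rfl fun j _ => ?_
    have : m₁ (T ⁻¹' {j.1}) = ∑ i, ENNReal.ofReal (w i j) := by
      rw [← ENNReal.ofReal_sum_of_nonneg fun i _ => hw i j, hw₁, ofReal_measureReal]
    rw [this, Finset.sum_mul]
    rfl
  refine ⟨σ, ⟨⟨?_⟩, hσ₀, hσ₁⟩, ?_⟩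
  · have := Measure.isProbabilityMeasure_map (μ := m₀) T.measurable.aemeasurable
    have h := measure_univ (μ := m₀.map T)
    rwa [← hσ₀, Measure.map_apply measurable_fst .univ, preimage_univ] at h
  · simp only [σ, lintegral_finsetSum_measure, lintegral_smul_measure, smul_eq_mul]
    refine le_trans (le_of_eq ?_) (ENNReal.ofReal_le_ofReal hwc)
    rw [ENNReal.ofReal_sum_of_nonneg fun i _ => Finset.sum_nonneg fun j _ =>
      mul_nonneg (hw i j) dist_nonneg]
    refine Finset.sum_congr rfl fun i _ => ?_
    rw [ENNReal.ofReal_sum_of_nonneg fun j _ => mul_nonneg (hw i j) dist_nonneg]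
    refine Finset.sum_congr rfl fun j _ => ?_
    rw [lintegral_dirac' _ (by fun_prop), ENNReal.ofReal_mul (hw i j), edist_dist]

variable [CompleteSpace X]

/-- Couplings of the images under `T` lift to couplings of the original measures. -/
lemma exists_coupling_lift [Nonempty X] [IsProbabilityMeasure m₀] [IsProbabilityMeasure m₁]
    {T : X → X} (hT : Measurable T) {σ : Measure (X × X)}
    (hσ : σ ∈ couplings (m₀.map T) (m₁.map T)) :
    ∃ ρ ∈ couplings m₀ m₁, ρ.map (Prod.map T T) = σ := by
  obtain ⟨hσp, hσ₀, hσ₁⟩ := hσ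
  -- The first gluing lifts the first coordinate to `m₀`; after a swap, a second one lifts the other
  -- to `m₁`.
  obtain ⟨ν, hν, hν₀, hνσ⟩ := exists_gluing m₀ σ hT hσ₀
  have hνsnd : ν.map Prod.snd = m₁.map T := by
    rw [← hσ₁, ← hνσ, Measure.map_map (by fun_prop) (by fun_prop)]
    rfl
  have : IsProbabilityMeasure (ν.map Prod.swap) :=
    Measure.isProbabilityMeasure_map (by fun_prop)
  obtain ⟨κ, hκ, hκ₁, hκν⟩ := exists_gluing m₁ (ν.map Prod.swap) hT (by
    rw [Measure.map_map (by fun_prop) (by fun_prop), ← hνsnd]; rfl)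
  refine ⟨κ.map Prod.swap, ⟨Measure.isProbabilityMeasure_map (by fun_prop), ?_, ?_⟩, ?_⟩
  · rw [Measure.map_map (by fun_prop) (by fun_prop), ← hν₀]
    have : ν = (κ.map fun p => (T p.1, p.2)).map Prod.swap := by
      rw [hκν, Measure.map_map (by fun_prop) (by fun_prop)]
      simp
    rw [this, Measure.map_map (by fun_prop) (by fun_prop),
      Measure.map_map (by fun_prop) (by fun_prop)]
    rfl
  · rw [Measure.map_map (by fun_prop) (by fun_prop), ← hκ₁]
    rfl
  · have : ν = (κ.map fun p => (T p.1, p.2)).map Prod.swap := by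
      rw [hκν, Measure.map_map (by fun_prop) (by fun_prop)]
      simp
    rw [← hνσ, this, Measure.map_map (by fun_prop) (by fun_prop),
      Measure.map_map (by fun_prop) (by fun_prop), Measure.map_map (by fun_prop) (by fun_prop)]
    rfl

/-- Lift the discrete coupling and use the triangle inequality through `T`: `2 * ε` comes from the
discrete duality and `ε` from each displacement to the atoms. -/
lemma exists_coupling_lintegral_edist_le (hm₀ : FiniteFirstMoment m₀)
    (hm₁ : FiniteFirstMoment m₁) {ε : ℝ} (hε : 0 < ε) :
    ∃ ρ ∈ couplings m₀ m₁, ∫⁻ p, edist p.1 p.2 ∂ρ ≤ ENNReal.ofReal (krDist m₀ m₁ + 4 * ε) := by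
  have hp₀ := hm₀.1
  have hp₁ := hm₁.1
  obtain ⟨x₀, -⟩ := hm₀.2
  have : Nonempty X := ⟨x₀⟩
  obtain ⟨T, hT₀, hT₁⟩ := exists_simpleFunc_lintegral_edist_le hm₀ hm₁ hε
  have hT : Measurable T := T.measurable
  obtain ⟨σ, hσ, hσc⟩ := exists_coupling_map_simpleFunc hm₀ hm₁ T hε.le hT₀ hT₁
  obtain ⟨ρ, hρ, rfl⟩ := exists_coupling_lift hT hσ
  refine ⟨ρ, hρ, ?_⟩
  have e₀ : ∫⁻ p, edist p.1 (T p.1) ∂ρ ≤ ENNReal.ofReal ε := by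
    rwa [← hρ.2.1, lintegral_map (by fun_prop) (by fun_prop)] at hT₀
  have e₁ : ∫⁻ p, edist p.2 (T p.2) ∂ρ ≤ ENNReal.ofReal ε := by
    rwa [← hρ.2.2, lintegral_map (by fun_prop) (by fun_prop)] at hT₁
  rw [lintegral_map (by fun_prop) (by fun_prop)] at hσc
  calc ∫⁻ p, edist p.1 p.2 ∂ρ
      ≤ ∫⁻ p, (edist p.1 (T p.1) + edist (T p.1) (T p.2) + edist p.2 (T p.2)) ∂ρ := by
        refine lintegral_mono fun p => ?_
        rw [edist_comm p.2 (T p.2)]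
        exact edist_triangle4 _ _ _ _
    _ ≤ ENNReal.ofReal ε + ENNReal.ofReal (krDist m₀ m₁ + 2 * ε) + ENNReal.ofReal ε := by
        rw [lintegral_add_left (by fun_prop), lintegral_add_left (by fun_prop)]
        exact add_le_add (add_le_add e₀ hσc) e₁
    _ = ENNReal.ofReal (krDist m₀ m₁ + 4 * ε) := by
        have := krDist_nonneg hm₀ hm₁
        rw [← ENNReal.ofReal_add (by linarith) (by linarith),
          ← ENNReal.ofReal_add (by linarith) (by linarith)]
        congr 1
        ring

/-- **Kantorovich–Rubinstein duality**: the cost of an optimal coupling is at most `krDist`. -/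
theorem IsOptimalCoupling.lintegral_edist_le (hm₀ : FiniteFirstMoment m₀)
    (hm₁ : FiniteFirstMoment m₁) {ρ : Measure (X × X)} (hρ : IsOptimalCoupling m₀ m₁ ρ) :
    ∫⁻ p, edist p.1 p.2 ∂ρ ≤ ENNReal.ofReal (krDist m₀ m₁) := by
  have hlim : Tendsto (fun ε : ℝ => ENNReal.ofReal (krDist m₀ m₁ + 4 * ε)) (𝓝[>] 0)
      (𝓝 (ENNReal.ofReal (krDist m₀ m₁))) := by
    have : Continuous fun ε : ℝ => ENNReal.ofReal (krDist m₀ m₁ + 4 * ε) :=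
      ENNReal.continuous_ofReal.comp (by fun_prop)
    simpa using (this.tendsto 0).mono_left nhdsWithin_le_nhds
  refine ge_of_tendsto hlim ?_
  filter_upwards [self_mem_nhdsWithin] with ε hε
  obtain ⟨ρ', hρ', hle⟩ := exists_coupling_lintegral_edist_le hm₀ hm₁ hε
  exact (hρ.2 ρ' hρ').trans hle

end KantorovichRubinstein

end MFO

/-! ### Gradient inequality and bounds on aggregates -/

section Gradient

variable {H : Type*} [NormedAddCommGroup H] [InnerProductSpace ℝ H] [CompleteSpace H]

/-- The gradient inequality for convex functions. -/
lemma ConvexOn.sub_le_inner_gradient {f : H → ℝ} (hf : ConvexOn ℝ univ f) {b : H}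
    (hd : DifferentiableAt ℝ f b) (a : H) : f b - f a ≤ inner ℝ (gradient f b) (b - a) := by
  have hconv : ConvexOn ℝ univ fun t : ℝ => f (AffineMap.lineMap a b t) :=
    hf.comp_affineMap (AffineMap.lineMap a b)
  have hderiv : HasDerivAt (fun t : ℝ => f (AffineMap.lineMap a b t))
      (inner ℝ (gradient f b) (b - a)) 1 := by
    have h₁ : HasFDerivAt f (InnerProductSpace.toDual ℝ H (gradient f b))
        (AffineMap.lineMap a b (1 : ℝ)) := by
      rw [AffineMap.lineMap_apply_one]
      exact hd.hasGradientAt.hasFDerivAt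
    exact h₁.comp_hasDerivAt (1 : ℝ) AffineMap.hasDerivAt_lineMap
  -- Along the segment, the secant slope over `[0, 1]` is at most the derivative at the right end.
  have h := hconv.slope_le_of_hasDerivAt (mem_univ 0) (mem_univ 1) zero_lt_one hderiv
  simpa [slope_def_field] using h

end Gradient

lemma norm_integral_le_of_forall_norm_le {α H : Type*} [MeasurableSpace α] [NormedAddCommGroup H]
    [NormedSpace ℝ H] {g : α → H} {B : ℝ} (hB : ∀ z, ‖g z‖ ≤ B) (μ : Measure α)
    [IsProbabilityMeasure μ] : ‖∫ z, g z ∂μ‖ ≤ B := by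
  simpa using norm_integral_le_of_norm_le_const (μ := μ) (.of_forall hB)

namespace MFO

section Constants

variable {X Y H : Type*} [NormedAddCommGroup H] {F : X → Set Y} {g : graph F → H}

lemma constM_nonneg : 0 ≤ constM g := Real.iSup_nonneg fun _ => norm_nonneg _

variable [MeasurableSpace X] [MeasurableSpace Y] [InnerProductSpace ℝ H] [CompleteSpace H]
  {f : H → ℝ}

lemma constC_nonneg : 0 ≤ constC g f := Real.iSup_nonneg fun _ => norm_nonneg _

end Constants

/-! ### Feasibility of the problem and of the bridging method -/

section Feasibility

variable {X Y H : Type*} [MetricSpace X] [MeasurableSpace X] [MeasurableSpace Y]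
  [NormedAddCommGroup H] {F : X → Set Y} {g : graph F → H} {Lg : ℝ}
  {m₀ m₁ : Measure X} {μ₀ μ₁ : Measure (graph F)}

lemma IsBridgingOutput.mem_admissible (h : IsBridgingOutput g Lg m₀ m₁ μ₀ μ₁) :
    μ₁ ∈ admissible F m₁ := by
  obtain ⟨ρ, ν, s, hρ, hν, -, hνρ, hs, hst, rfl⟩ := h
  refine ⟨Measure.isProbabilityMeasure_map hs.aemeasurable, ?_⟩
  rw [Measure.map_map (by fun_prop) hs, ← hρ.1.2.2, ← hνρ,
    Measure.map_map (by fun_prop) (by fun_prop)]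
  exact congrArg (fun t => ν.map t) (funext fun p => (hst p).1)

variable [BorelSpace X] [SecondCountableTopology X] [MetricSpace Y] [BorelSpace Y]
  [SecondCountableTopology Y]

lemma admissible_nonempty (hF : IsClosed (graph F)) (hn : ∀ x, (F x).Nonempty)
    (hstab : StabilityAssumption g Lg) (m : Measure X) [IsProbabilityMeasure m] :
    (admissible F m).Nonempty := by
  obtain ⟨s, hs, hsx⟩ := exists_measurable_section hF hn hstab.compact hstab.usc
  refine ⟨m.map s, Measure.isProbabilityMeasure_map hs.aemeasurable, ?_⟩
  rw [Measure.map_map (by fun_prop) hs]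
  have : (fun z : graph F => z.1.1) ∘ s = id := funext hsx
  rw [this, Measure.map_id]

/-- The bridging method can be carried out. -/
lemma exists_isBridgingOutput [CompleteSpace X] (hF : IsClosed (graph F))
    (hstab : StabilityAssumption g Lg) (hm₀ : FiniteFirstMoment m₀) (hm₁ : FiniteFirstMoment m₁)
    (hμ₀ : μ₀ ∈ admissible F m₀) :
    ∃ μ₁, IsBridgingOutput g Lg m₀ m₁ μ₀ μ₁ := by
  have := hm₀.1
  have := hm₁.1
  have := hμ₀.1
  obtain ⟨x₀, -⟩ := hm₀.2
  have : Nonempty X := ⟨x₀⟩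
  obtain ⟨ρ, hρ⟩ := exists_isOptimalCoupling m₀ m₁
  have := hρ.1.1
  obtain ⟨ν, hν, hν₀, hνρ⟩ := exists_gluing μ₀ ρ (h := fun z : graph F => z.1.1) (by fun_prop)
    (hρ.1.2.1.trans hμ₀.2.symm)
  obtain ⟨s, hs, hst⟩ := exists_measurable_transfer hF hstab
  exact ⟨_, ρ, ν, s, hρ, hν, hν₀, hνρ, hs, hst, rfl⟩

end Feasibility

/-! ### Stability of values and approximate minimizers -/

section Stability

variable {X Y H : Type*} [MetricSpace X] [MeasurableSpace X] [MetricSpace Y] [MeasurableSpace Y]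
  [NormedAddCommGroup H] [InnerProductSpace ℝ H] [CompleteSpace H]
  {F : X → Set Y} {g : graph F → H} {f : H → ℝ} {L : ℝ≥0} {Lg : ℝ}

/-- All aggregates lie in a ball, on which the Lipschitz gradient is bounded; hence the supremum
`constC` is not a default value. -/
lemma CostAssumption.norm_gradient_le_constC (hcost : CostAssumption g f L)
    (μ : Measure (graph F)) [IsProbabilityMeasure μ] :
    ‖gradient f (∫ z, g z ∂μ)‖ ≤ constC g f := by
  obtain ⟨B, hB⟩ := hcost.bounded
  refine le_ciSup (f := fun μ : ProbabilityMeasure (graph F) =>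
    ‖gradient f (∫ z, g z ∂(μ : Measure (graph F)))‖) ?_ ⟨μ, inferInstance⟩
  refine ⟨‖gradient f 0‖ + L * B, ?_⟩
  rintro _ ⟨μ', rfl⟩
  have h₁ := hcost.lipschitz_gradient.dist_le_mul (∫ z, g z ∂(μ' : Measure (graph F))) 0
  have h₂ := norm_integral_le_of_forall_norm_le hB (μ' : Measure (graph F))
  rw [dist_eq_norm, dist_zero_right] at h₁
  have h₃ := norm_le_norm_add_norm_sub' (gradient f (∫ z, g z ∂(μ' : Measure (graph F))))
    (gradient f 0)
  have h₄ := mul_le_mul_of_nonneg_left h₂ L.2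
  simp only [NNReal.val_eq_coe] at h₄
  show ‖gradient f (∫ z, g z ∂(μ' : Measure (graph F)))‖ ≤ _
  linarith

/-- The tangent of `f` at 0 is an affine minorant, bounded below on the ball containing all
aggregates. -/
lemma CostAssumption.bddBelow_cost (hcost : CostAssumption g f L) (m : Measure X) :
    BddBelow (cost g f '' admissible F m) := by
  obtain ⟨B, hB⟩ := hcost.bounded
  refine ⟨f 0 - ‖gradient f 0‖ * B, ?_⟩
  rintro _ ⟨μ, ⟨hμ, -⟩, rfl⟩
  have h₁ := hcost.convex.sub_le_inner_gradient (hcost.differentiable 0) (∫ z, g z ∂μ)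
  have h₂ := real_inner_le_norm (gradient f 0) (0 - ∫ z, g z ∂μ)
  have h₃ := mul_le_mul_of_nonneg_left (norm_integral_le_of_forall_norm_le hB μ)
    (norm_nonneg (gradient f 0))
  rw [zero_sub, norm_neg] at h₂
  rw [zero_sub] at h₁
  show _ ≤ f (∫ z, g z ∂μ)
  linarith

variable [BorelSpace X] [SecondCountableTopology X] [BorelSpace Y] [SecondCountableTopology Y]
  {m₀ m₁ : Measure X} {μ₀ μ₁ : Measure (graph F)}

lemma isGLB_val (hF : IsClosed (graph F)) (hn : ∀ x, (F x).Nonempty)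
    (hcost : CostAssumption g f L) (hstab : StabilityAssumption g Lg) (m : Measure X)
    [IsProbabilityMeasure m] : IsGLB (cost g f '' admissible F m) (val g f m) :=
  isGLB_csInf ((admissible_nonempty hF hn hstab m).image _) (hcost.bddBelow_cost m)

variable [CompleteSpace X]

/-- The bridging method moves the aggregate `∫ g` by at most `Lg * krDist m₀ m₁`. -/
lemma IsBridgingOutput.norm_integral_sub_le (hcost : CostAssumption g f L)
    (hstab : StabilityAssumption g Lg) (hm₀ : FiniteFirstMoment m₀) (hm₁ : FiniteFirstMoment m₁)
    (h : IsBridgingOutput g Lg m₀ m₁ μ₀ μ₁) :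
    ‖(∫ z, g z ∂μ₁) - ∫ z, g z ∂μ₀‖ ≤ Lg * krDist m₀ m₁ := by
  obtain ⟨ρ, ν, s, hρ, hν, hν₀, hνρ, hs, hst, rfl⟩ := h
  obtain ⟨B, hB⟩ := hcost.bounded
  have hg : StronglyMeasurable g := hstab.continuous.stronglyMeasurable
  have hle := hρ.lintegral_edist_le hm₀ hm₁
  rw [← hνρ, lintegral_map (by fun_prop) (by fun_prop)] at hle
  rw [integral_map hs.aemeasurable hg.aestronglyMeasurable, ← hν₀,
    integral_map (by fun_prop) hg.aestronglyMeasurable, ← integral_sub]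
  · have hdist : Integrable (fun p : graph F × X => dist p.1.1.1 p.2) ν := by
      refine ⟨by fun_prop, ?_⟩
      refine lt_of_le_of_lt (lintegral_mono fun p => ?_) (hle.trans_lt ENNReal.ofReal_lt_top)
      rw [Real.enorm_of_nonneg dist_nonneg, edist_dist]
    have hint : ∫ p, dist p.1.1.1 p.2 ∂ν ≤ krDist m₀ m₁ := by
      rw [integral_eq_lintegral_of_nonneg_ae (.of_forall fun _ => dist_nonneg)
        hdist.aestronglyMeasurable]
      refine ENNReal.toReal_le_of_le_ofReal (krDist_nonneg hm₀ hm₁) ?_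
      simpa only [edist_dist] using hle
    calc ‖∫ p, (g (s p) - g p.1) ∂ν‖
        ≤ ∫ p, Lg * dist p.1.1.1 p.2 ∂ν :=
          norm_integral_le_of_norm_le (hdist.const_mul Lg) (.of_forall fun p => (hst p).2)
      _ = Lg * ∫ p, dist p.1.1.1 p.2 ∂ν := integral_const_mul _ _
      _ ≤ Lg * krDist m₀ m₁ := mul_le_mul_of_nonneg_left hint hstab.modulus_nonneg
  · exact .of_bound (hg.comp_measurable hs).aestronglyMeasurable B (.of_forall fun p => hB _)
  · exact .of_bound (hg.comp_measurable measurable_fst).aestronglyMeasurable B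
      (.of_forall fun p => hB _)

lemma IsBridgingOutput.cost_le (hcost : CostAssumption g f L)
    (hstab : StabilityAssumption g Lg) (hm₀ : FiniteFirstMoment m₀) (hm₁ : FiniteFirstMoment m₁)
    (h : IsBridgingOutput g Lg m₀ m₁ μ₀ μ₁) :
    cost g f μ₁ ≤ cost g f μ₀ + Lg * (constC g f + L * constM g) * krDist m₀ m₁ := by
  have := h.mem_admissible.1
  have hLM : 0 ≤ L * constM g := mul_nonneg L.2 constM_nonneg
  have hbound : 0 ≤ Lg * krDist m₀ m₁ :=
    mul_nonneg hstab.modulus_nonneg (krDist_nonneg hm₀ hm₁)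
  have h₁ := hcost.convex.sub_le_inner_gradient (hcost.differentiable (∫ z, g z ∂μ₁))
    (∫ z, g z ∂μ₀)
  have h₂ := real_inner_le_norm (gradient f (∫ z, g z ∂μ₁)) ((∫ z, g z ∂μ₁) - ∫ z, g z ∂μ₀)
  have h₃ := mul_le_mul (hcost.norm_gradient_le_constC μ₁)
    (h.norm_integral_sub_le hcost hstab hm₀ hm₁) (norm_nonneg _) constC_nonneg
  -- Taking the gradient at the output `μ₁` already gives the constant `C`; the term `L * M` only
  -- enlarges the bound.
  have h₄ := mul_nonneg hLM hbound
  show f (∫ z, g z ∂μ₁) ≤ f (∫ z, g z ∂μ₀) + _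
  linarith

/-- Bridging turns every competitor for `m₀` into one for `m₁` at a controlled extra cost; take the
infimum over the former. -/
lemma val_le_val_add (hF : IsClosed (graph F)) (hn : ∀ x, (F x).Nonempty)
    (hcost : CostAssumption g f L) (hstab : StabilityAssumption g Lg)
    (hm₀ : FiniteFirstMoment m₀) (hm₁ : FiniteFirstMoment m₁) :
    val g f m₁ ≤ val g f m₀ + Lg * (constC g f + L * constM g) * krDist m₀ m₁ := by
  have := hm₀.1
  have := hm₁.1
  rw [← sub_le_iff_le_add]
  refine (isGLB_val hF hn hcost hstab m₀).2 ?_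
  rintro _ ⟨μ₀, hμ₀, rfl⟩
  obtain ⟨μ₁, hμ₁⟩ := exists_isBridgingOutput hF hstab hm₀ hm₁ hμ₀
  have h₁ := (isGLB_val hF hn hcost hstab m₁).1 ⟨μ₁, hμ₁.mem_admissible, rfl⟩
  linarith [hμ₁.cost_le hcost hstab hm₀ hm₁]

/-- The error is paid twice: for passing from `μ₀` to `μ₁`, and for comparing the value at `m₀` with
that at `m₁`. -/
lemma IsBridgingOutput.isApproxMinimizer (hF : IsClosed (graph F)) (hn : ∀ x, (F x).Nonempty)
    (hcost : CostAssumption g f L) (hstab : StabilityAssumption g Lg)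
    (hm₀ : FiniteFirstMoment m₀) (hm₁ : FiniteFirstMoment m₁) {ε : ℝ}
    (hμ₀ : IsApproxMinimizer g f m₀ ε μ₀) (h : IsBridgingOutput g Lg m₀ m₁ μ₀ μ₁) :
    IsApproxMinimizer g f m₁
      (ε + 2 * Lg * (constC g f + L * constM g) * krDist m₀ m₁) μ₁ := by
  have := hm₀.1
  have := hm₁.1
  refine ⟨h.mem_admissible, fun μ' hμ' => ?_⟩
  have h₀ : cost g f μ₀ - ε ≤ val g f m₀ := (isGLB_val hF hn hcost hstab m₀).2 (by
    rintro _ ⟨μ, hμ, rfl⟩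
    linarith [hμ₀.2 μ hμ])
  have h₁ := (isGLB_val hF hn hcost hstab m₁).1 ⟨μ', hμ', rfl⟩
  have h₂ := val_le_val_add hF hn hcost hstab hm₁ hm₀
  rw [krDist_comm] at h₂
  have h₃ := h.cost_le hcost hstab hm₀ hm₁
  linarith

end Stability

end MFO

theorem theorem4p1
    {E : Type*} [NormedAddCommGroup E] [NormedSpace ℝ E] [CompleteSpace E]
    [TopologicalSpace.SeparableSpace E] [MeasurableSpace E] [BorelSpace E]
    (X : Set E) (hX : IsClosed X)
    {Y : Type*} [MetricSpace Y] [CompleteSpace Y] [TopologicalSpace.SeparableSpace Y]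
    [MeasurableSpace Y] [BorelSpace Y]
    {H : Type*} [NormedAddCommGroup H] [InnerProductSpace ℝ H] [CompleteSpace H]
    [TopologicalSpace.SeparableSpace H]
    (F : X → Set Y) (hF_closed : IsClosed (MFO.graph F)) (hF_nonempty : ∀ x, (F x).Nonempty)
    (g : MFO.graph F → H) (f : H → ℝ) (L : NNReal) (Lg : ℝ)
    (hcost : MFO.CostAssumption g f L) (hstab : MFO.StabilityAssumption g Lg)
    (m₀ m₁ : MeasureTheory.Measure X)
    (hm₀ : MFO.FiniteFirstMoment m₀) (hm₁ : MFO.FiniteFirstMoment m₁) :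
    -- the two values are genuine (finite) infima, and they are close to each other
    (IsGLB (MFO.cost g f '' MFO.admissible F m₀) (MFO.val g f m₀) ∧
      IsGLB (MFO.cost g f '' MFO.admissible F m₁) (MFO.val g f m₁) ∧
      |MFO.val g f m₀ - MFO.val g f m₁| ≤
        Lg * (MFO.constC g f + L * MFO.constM g) * MFO.krDist m₀ m₁) ∧
    -- the bridging method has an output, and each output is an approximate minimizer
    (∀ (ε₀ : ℝ) (μ₀ : MeasureTheory.Measure (MFO.graph F)), 0 ≤ ε₀ →
      MFO.IsApproxMinimizer g f m₀ ε₀ μ₀ →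
      (∃ μ₁, MFO.IsBridgingOutput g Lg m₀ m₁ μ₀ μ₁) ∧
      ∀ μ₁, MFO.IsBridgingOutput g Lg m₀ m₁ μ₀ μ₁ →
        MFO.IsApproxMinimizer g f m₁
          (ε₀ + 2 * Lg * (MFO.constC g f + L * MFO.constM g) * MFO.krDist m₀ m₁) μ₁) := by

  have := UniformSpace.secondCountable_of_separable E
  have := UniformSpace.secondCountable_of_separable Y
  have : CompleteSpace X := hX.completeSpace_coe
  have := hm₀.1
  have := hm₁.1
  refine ⟨⟨MFO.isGLB_val hF_closed hF_nonempty hcost hstab m₀,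
    MFO.isGLB_val hF_closed hF_nonempty hcost hstab m₁, abs_sub_le_iff.2 ⟨?_, ?_⟩⟩,
    fun ε₀ μ₀ _ hμ₀ => ⟨MFO.exists_isBridgingOutput hF_closed hstab hm₀ hm₁ hμ₀.1,
      fun μ₁ h => h.isApproxMinimizer hF_closed hF_nonempty hcost hstab hm₀ hm₁ hμ₀⟩⟩
  · have h := MFO.val_le_val_add hF_closed hF_nonempty hcost hstab hm₁ hm₀
    rw [MFO.krDist_comm] at h
    linarith
  · have h := MFO.val_le_val_add hF_closed hF_nonempty hcost hstab hm₀ hm₁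
    linarith
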